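/- Let $\mathfrak H=\mathbb Q\langle x,y\rangle$ be the noncommutative polynomial algebra in two indeterminates, and put $\mathfrak H^0=\mathbb Q+x\mathfrak Hy$ and $z_k=x^{k-1}y$ for $k\ge 1$. Let $I^1$ be the set of all tuples $(k_1,\dots,k_l)$ of positive integers with $l\ge1$; let $I^0$ be the set of those with $k_1\ge2$, and $\check I^1$ the set of those in which not all $k_i$ equal $1$. The weight of a tuple is $k_1+\dots+k_l$. Let $\check{\mathfrak H}^1$ (respectively $\check{\mathfrak H}^1_k$) be the $\mathbb Q$-span of the monomials $z_{k_1}\cdots z_{k_l}$ with $(k_1,\dots,k_l)\in\check I^1$ (respectively, in $\check I^1$ and of weight $k$), and let $\mathfrak H^0_k$ be the $\mathbb Q$-span of the monomials $z_{k_1}\cdots z_{k_l}$ with $(k_1,\dots,k_l)\in I^0$ of weight $k$. Define the $\mathbb Q$-linear map $\bar Z\colon\mathfrak H^0\to\mathbb R$ by $\bar Z(1)=1$ and $$\bar Z(z_{k_1}\cdots z_{k_l})=\zeta^\star(k_1,\dots,k_l)=\sum_{n_1\ge\cdots\ge n_l\ge1}\frac1{n_1^{k_1}\cdots n_l^{k_l}}\qquad\text{for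 }(k_1,\dots,k_l)\in I^0 .$$ Let $\gamma$ be the algebra automorphism of $\mathfrak H$ with $\gamma(x)=x$ and $\gamma(y)=x+y$. For $a,b,w_1,w_2\in\mathfrak H$ put $a\diamond(w_1\otimes w_2)\diamond b=w_1b\otimes aw_2$, extended linearly to $\mathfrak H\otimes_{\mathbb Q}\mathfrak H$. Let $\bar{\mathcal C}_0\colon\mathfrak H\to\mathfrak H\otimes_{\mathbb Q}\mathfrak H$ be the $\mathbb Q$-linear map with $\bar{\mathcal C}_0(1)=0$, $\bar{\mathcal C}_0(x)=x\otimes y$, $\bar{\mathcal C}_0(y)=-x\otimes y$ and $$\bar{\mathcal C}_0(ww')=\bar{\mathcal C}_0(w)\diamond\gamma^{-1}(w')+\gamma^{-1}(w)\diamond\bar{\mathcal C}_0(w')\qquad(w,w'\in\mathfrak H),$$ and put $\bar\rho_0=M_0\circ\bar{\mathcal C}_0\colon\mathfrak H\to\mathfrak H$, where $M_0(w_1\otimes w_2)=w_1w_2$. Then $\bar\rho_0(\check{\mathfrak H}^1)\subset\operatorname{Ker}\bar Z$, and $\bar\rho_0(\check{\mathfrak H}^1_{k-1})\subset\operatorname{Ker}\bar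 Z\cap\mathfrak H^0_k$ for every integer $k\ge2$. -/

import Mathlib

open scoped TensorProduct

namespace CyclicSum

/-- The two letters `x` and `y`. -/
inductive Letter : Type
  | x : Letter
  | y : Letter

/-- Hoffman's algebra `ℚ⟨x, y⟩`, the noncommutative polynomial algebra in two indeterminates. -/
abbrev H : Type := FreeAlgebra ℚ Letter

noncomputable def x : H := FreeAlgebra.ι ℚ Letter.x

noncomputable def y : H := FreeAlgebra.ι ℚ Letter.y

/-- `z_k = x^(k-1) y`; only used for `k ≥ 1`. -/
noncomputable def z (k : ℕ) : H := x ^ (k - 1) * y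

/-- The monomial `z_{k_1} ⋯ z_{k_l}` of a multi-index `(k_1, …, k_l)`. -/
noncomputable def zProd (k : List ℕ) : H := (k.map z).prod

/-! ### Multi-indices; the depth is the length of the list, the weight its sum. -/

/-- `I^1`: all nonempty tuples of positive integers. -/
def indexOne : Set (List ℕ) := {k | k ≠ [] ∧ ∀ a ∈ k, 1 ≤ a}

/-- `I^0`: those with `k_1 ≥ 2`. -/
def indexZero : Set (List ℕ) := {k | k ∈ indexOne ∧ ∃ a ∈ k.head?, 2 ≤ a}

/-- `Ǐ^1`: those whose entries are not all equal to `1`. -/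
def indexCheck : Set (List ℕ) := {k | k ∈ indexOne ∧ ¬ ∀ a ∈ k, a = 1}

/-! ### Subspaces of Hoffman's algebra -/

/-- `H^0 = ℚ + x H y`. -/
noncomputable def HZero : Submodule ℚ H :=
  Submodule.span ℚ {1} ⊔ Submodule.span ℚ {v | ∃ w : H, v = x * w * y}

/-- `H_k^0`, the weight `k` part of `x H y`. -/
noncomputable def HZeroWeight (k : ℕ) : Submodule ℚ H :=
  Submodule.span ℚ (zProd '' {i | i ∈ indexZero ∧ i.sum = k})

/-- `Ȟ^1`. -/
noncomputable def HCheck : Submodule ℚ H := Submodule.span ℚ (zProd '' indexCheck)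

/-- `Ȟ_k^1`. -/
noncomputable def HCheckWeight (k : ℕ) : Submodule ℚ H :=
  Submodule.span ℚ (zProd '' {i | i ∈ indexCheck ∧ i.sum = k})

/-! ### Multiple zeta-star values and the evaluation map -/

/-- `ζ⋆(k_1, …, k_l) = ∑_{n_1 ≥ ⋯ ≥ n_l ≥ 1} 1 / (n_1^{k_1} ⋯ n_l^{k_l})`.
The series of nonnegative terms converges for indices in `indexZero`. -/
noncomputable def zetaStar (k : List ℕ) : ℝ :=
  ∑' n : {n : Fin k.length → ℕ+ // Antitone n}, ∏ i, 1 / ((n.1 i : ℕ) : ℝ) ^ (k.get i)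

/-- Reads the exponents off a word: `x^{a-1} y x^{b-1} y ⋯` gives `[c + a, b, …]`. -/
def wordIndexAux : ℕ → List Letter → List ℕ
  | _, [] => []
  | c, Letter.x :: w => wordIndexAux (c + 1) w
  | c, Letter.y :: w => (c + 1) :: wordIndexAux 0 w

/-- The multi-index `(k_1, …, k_l)` of the word `z_{k_1} ⋯ z_{k_l}`. -/
def wordIndex (w : FreeMonoid Letter) : List ℕ := wordIndexAux 0 w.toList

/-- The basis of Hoffman's algebra consisting of the words in `x` and `y`. -/
noncomputable abbrev wordBasis : Module.Basis (FreeMonoid Letter) ℚ H :=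
  FreeAlgebra.basisFreeMonoid ℚ Letter

/-- The evaluation map `Z̄ : H^0 → ℝ`, with `Z̄ 1 = 1` and `Z̄ (z_{k_1} ⋯ z_{k_l}) = ζ⋆(k_1, …, k_l)`
(see `ZBar_one` and `ZBar_zProd`); words outside `H^0` play no role. -/
noncomputable def ZBar : HZero →ₗ[ℚ] ℝ :=
  (wordBasis.constr ℚ fun w => zetaStar (wordIndex w)).domRestrict HZero

/-! ### The automorphism `γ` and the operator `ρ̄₀` -/

/-- The algebra automorphism with `γ x = x` and `γ y = x + y`. -/
noncomputable def gamma : H ≃ₐ[ℚ] H :=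
  AlgEquiv.ofAlgHom
    (FreeAlgebra.lift ℚ fun | Letter.x => x | Letter.y => x + y)
    (FreeAlgebra.lift ℚ fun | Letter.x => x | Letter.y => y - x)
    (by ext u; cases u <;> simp [x, y])
    (by ext u; cases u <;> simp [x, y])

/-- `a ⋄ (w₁ ⊗ w₂) ⋄ b = w₁ b ⊗ a w₂`. -/
noncomputable def diamond (a : H) (t : H ⊗[ℚ] H) (b : H) : H ⊗[ℚ] H :=
  TensorProduct.map (LinearMap.mulRight ℚ b) (LinearMap.mulLeft ℚ a) t

/-- `C̄₀` on the letters: `x ↦ x ⊗ y` and `y ↦ -(x ⊗ y)`. -/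
noncomputable def CBarLetter : Letter → H ⊗[ℚ] H
  | Letter.x => x ⊗ₜ[ℚ] y
  | Letter.y => -(x ⊗ₜ[ℚ] y)

/-- `C̄₀` on words, by the product rule. -/
noncomputable def CBarWord : List Letter → H ⊗[ℚ] H
  | [] => 0
  | u :: w =>
    diamond 1 (CBarLetter u) (gamma.symm ((w.map (FreeAlgebra.ι ℚ)).prod)) +
      diamond (gamma.symm (FreeAlgebra.ι ℚ u)) (CBarWord w) 1

/-- The linear map `C̄₀ : H → H ⊗ H`. It is characterised by `CBar_one`, `CBar_x`, `CBar_y` and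
the product rule `CBar_mul`. -/
noncomputable def CBar : H →ₗ[ℚ] H ⊗[ℚ] H :=
  wordBasis.constr ℚ fun w => CBarWord w.toList

/-- `ρ̄₀ = M₀ ∘ C̄₀`, where `M₀ (w₁ ⊗ w₂) = w₁ w₂`. -/
noncomputable def rhoBar : H →ₗ[ℚ] H := LinearMap.mul' ℚ H ∘ₗ CBar

/-! ### The defining properties of `Z̄` and `C̄₀` -/

theorem wordBasis_apply (w : FreeMonoid Letter) :
    wordBasis w = (w.toList.map (FreeAlgebra.ι ℚ)).prod := by
  simp [wordBasis, FreeAlgebra.basisFreeMonoid, FreeAlgebra.equivMonoidAlgebraFreeMonoid,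
    FreeMonoid.lift_apply]

theorem CBar_prod (w : List Letter) :
    CBar ((w.map (FreeAlgebra.ι ℚ)).prod) = CBarWord w := by
  have h := wordBasis_apply (FreeMonoid.ofList w)
  simp only [FreeMonoid.toList_ofList] at h
  rw [← h, CBar, Module.Basis.constr_basis, FreeMonoid.toList_ofList]

theorem CBar_one : CBar 1 = 0 := by
  simpa [CBarWord] using CBar_prod []

theorem CBar_x : CBar x = x ⊗ₜ[ℚ] y := by
  simpa [CBarWord, CBarLetter, diamond, x] using CBar_prod [Letter.x]

theorem CBar_y : CBar y = -(x ⊗ₜ[ℚ] y) := by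
  simpa [CBarWord, CBarLetter, diamond, y] using CBar_prod [Letter.y]

theorem diamond_diamond (a a' b b' : H) (t : H ⊗[ℚ] H) :
    diamond a (diamond a' t b) b' = diamond (a * a') t (b * b') := by
  simp [diamond, ← LinearMap.comp_apply, ← TensorProduct.map_comp, ← LinearMap.mulLeft_mul,
    ← LinearMap.mulRight_mul]

theorem diamond_add (a b : H) (s t : H ⊗[ℚ] H) :
    diamond a (s + t) b = diamond a s b + diamond a t b := map_add _ _ _

theorem CBarWord_append (v w : List Letter) :
    CBarWord (v ++ w) =
      diamond 1 (CBarWord v) (gamma.symm ((w.map (FreeAlgebra.ι ℚ)).prod)) +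
        diamond (gamma.symm ((v.map (FreeAlgebra.ι ℚ)).prod)) (CBarWord w) 1 := by
  induction v with
  | nil => simp [CBarWord, diamond]
  | cons u v ih =>
    simp only [List.cons_append, CBarWord, ih, diamond_add, diamond_diamond, List.map_append,
      List.prod_append, List.map_cons, List.prod_cons, map_mul, one_mul, mul_one, add_assoc]

theorem diamond_smul (a b : H) (c : ℚ) (t : H ⊗[ℚ] H) :
    diamond a (c • t) b = c • diamond a t b := map_smul _ _ _

theorem diamond_add_right (a b b' : H) (t : H ⊗[ℚ] H) :
    diamond a t (b + b') = diamond a t b + diamond a t b' := by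
  induction t with
  | zero => simp [diamond]
  | tmul p q => simp [diamond, mul_add, TensorProduct.add_tmul]
  | add s t hs ht => simp only [diamond_add, hs, ht]; abel

theorem diamond_add_left (a a' b : H) (t : H ⊗[ℚ] H) :
    diamond (a + a') t b = diamond a t b + diamond a' t b := by
  induction t with
  | zero => simp [diamond]
  | tmul p q => simp [diamond, add_mul, TensorProduct.tmul_add]
  | add s t hs ht => simp only [diamond_add, hs, ht]; abel

theorem diamond_smul_right (a b : H) (c : ℚ) (t : H ⊗[ℚ] H) :
    diamond a t (c • b) = c • diamond a t b := by
  induction t with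
  | zero => simp [diamond]
  | tmul p q => simp [diamond, TensorProduct.smul_tmul']
  | add s t hs ht => simp only [diamond_add, hs, ht, smul_add]

theorem diamond_smul_left (a b : H) (c : ℚ) (t : H ⊗[ℚ] H) :
    diamond (c • a) t b = c • diamond a t b := by
  induction t with
  | zero => simp [diamond]
  | tmul p q => simp [diamond]
  | add s t hs ht => simp only [diamond_add, hs, ht, smul_add]

theorem diamond_zero (a b : H) : diamond a 0 b = 0 := map_zero _

theorem diamond_zero_right (a : H) (t : H ⊗[ℚ] H) : diamond a t 0 = 0 := by
  simpa using diamond_smul_right a 0 0 t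

theorem diamond_zero_left (b : H) (t : H ⊗[ℚ] H) : diamond 0 t b = 0 := by
  simpa using diamond_smul_left 0 b 0 t

theorem CBar_mul (v w : H) :
    CBar (v * w) = diamond 1 (CBar v) (gamma.symm w) + diamond (gamma.symm v) (CBar w) 1 := by
  have hv := wordBasis.mem_span v
  have hw := wordBasis.mem_span w
  induction hv using Submodule.span_induction with
  | zero => simp [diamond_zero, diamond_zero_left]
  | add v v' _ _ h h' =>
    simp only [add_mul, map_add, h, h', diamond_add, diamond_add_left]; abel
  | smul c v _ h => simp only [smul_mul_assoc, map_smul, h, diamond_smul, diamond_smul_left, smul_add]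
  | mem v hv =>
    obtain ⟨v, rfl⟩ := hv
    induction hw using Submodule.span_induction with
    | zero => simp [diamond_zero, diamond_zero_right]
    | add w w' _ _ h h' =>
      simp only [mul_add, map_add, h, h', diamond_add, diamond_add_right]; abel
    | smul c w _ h =>
      simp only [mul_smul_comm, map_smul, h, diamond_smul, diamond_smul_right, smul_add]
    | mem w hw =>
      obtain ⟨w, rfl⟩ := hw
      rw [wordBasis_apply, wordBasis_apply, ← List.prod_append, ← List.map_append, CBar_prod,
        CBar_prod, CBar_prod, CBarWord_append]

theorem zProd_eq_mul_y {k : List ℕ} (hk : k ≠ []) : ∃ w, zProd k = w * y := by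
  induction k with
  | nil => exact absurd rfl hk
  | cons a t ih =>
    by_cases ht : t = []
    · exact ⟨x ^ (a - 1), by simp [ht, zProd, z]⟩
    · obtain ⟨w, hw⟩ := ih ht
      refine ⟨z a * w, ?_⟩
      rw [mul_assoc, ← hw]
      simp [zProd]

theorem zProd_mem_HZero {k : List ℕ} (hk : k ∈ indexZero) : zProd k ∈ HZero := by
  obtain ⟨_, a, ha, h2⟩ := hk
  obtain ⟨t, rfl⟩ : ∃ t, k = a :: t := by
    cases k with
    | nil => simp at ha
    | cons b t => exact ⟨t, by simpa using ha⟩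
  refine Submodule.mem_sup_right (Submodule.subset_span ?_)
  obtain ⟨m, rfl⟩ := Nat.exists_eq_add_of_le h2
  have hz : z (2 + m) = x * x ^ m * y := by
    rw [z, ← pow_succ', show 2 + m - 1 = m + 1 by omega]
  by_cases ht : t = []
  · exact ⟨x ^ m, by simp [ht, zProd, hz]⟩
  · obtain ⟨w, hw⟩ := zProd_eq_mul_y ht
    refine ⟨x ^ m * y * w, ?_⟩
    have : zProd ((2 + m) :: t) = z (2 + m) * zProd t := by simp [zProd]
    rw [this, hw, hz]
    simp only [mul_assoc]

theorem wordIndexAux_block (c m : ℕ) (w : List Letter) :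
    wordIndexAux c (List.replicate m Letter.x ++ Letter.y :: w) =
      (c + m + 1) :: wordIndexAux 0 w := by
  induction m generalizing c with
  | zero => simp [wordIndexAux]
  | succ m ih =>
    simp only [List.replicate_succ, List.cons_append, wordIndexAux, ih]
    congr 1
    omega

theorem exists_word (k : List ℕ) (hk : ∀ a ∈ k, 1 ≤ a) :
    ∃ w : List Letter, wordIndexAux 0 w = k ∧ zProd k = (w.map (FreeAlgebra.ι ℚ)).prod := by
  induction k with
  | nil => exact ⟨[], rfl, rfl⟩
  | cons a t ih =>
    obtain ⟨w, h1, h2⟩ := ih fun b hb => hk b (List.mem_cons_of_mem _ hb)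
    have ha : 1 ≤ a := hk a List.mem_cons_self
    refine ⟨List.replicate (a - 1) Letter.x ++ Letter.y :: w, ?_, ?_⟩
    · rw [wordIndexAux_block, h1]
      congr 1
      omega
    · have : zProd (a :: t) = z a * zProd t := by simp [zProd]
      rw [this, h2]
      simp [z, x, y, mul_assoc]

theorem ZBar_prod (w : List Letter) (h : (w.map (FreeAlgebra.ι ℚ)).prod ∈ HZero) :
    ZBar ⟨(w.map (FreeAlgebra.ι ℚ)).prod, h⟩ = zetaStar (wordIndexAux 0 w) := by
  have hb := wordBasis_apply (FreeMonoid.ofList w)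
  simp only [FreeMonoid.toList_ofList] at hb
  rw [ZBar, LinearMap.domRestrict_apply]
  simp only [← hb]
  rw [Module.Basis.constr_basis, wordIndex, FreeMonoid.toList_ofList]

theorem zetaStar_nil : zetaStar [] = 1 := by
  have : Unique {n : Fin ([] : List ℕ).length → ℕ+ // Antitone n} :=
    { default := ⟨fun i => i.elim0, fun i => i.elim0⟩
      uniq := fun n => Subtype.ext (funext fun i => i.elim0) }
  rw [zetaStar, tsum_eq_single default fun b hb => absurd (Subsingleton.elim b default) hb]
  exact Fin.prod_univ_zero _

theorem one_mem_HZero : (1 : H) ∈ HZero :=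
  Submodule.mem_sup_left (Submodule.mem_span_singleton_self 1)

theorem ZBar_one : ZBar ⟨1, one_mem_HZero⟩ = 1 :=
  (ZBar_prod [] one_mem_HZero).trans zetaStar_nil

theorem ZBar_zProd {k : List ℕ} (hk : k ∈ indexZero) :
    ZBar ⟨zProd k, zProd_mem_HZero hk⟩ = zetaStar k := by
  obtain ⟨w, h1, h2⟩ := exists_word k hk.1.2
  have hm := zProd_mem_HZero hk
  simp only [h2] at hm ⊢
  rw [ZBar_prod w hm, h1]

end CyclicSum

/-! Write T(w) for `cyclicTrace w` and ζ(xwy) for the strict multiple zeta value `zetaWord w`.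
Replacing y by y - x removes the diagonal from a weak summation, so Z̄(x γ⁻¹(w) y) = ζ(xwy)
(`evalStar_gamma_symm`). Unfolding the product rule on a word s_1⋯s_r gives ρ̄₀(s_1⋯s_r) = Σ_i ε_i x
γ⁻¹(s_{i+1}⋯s_r s_1⋯s_{i-1}) y, with ε_i = 1 if s_i = x and ε_i = -1 if s_i = y. The claim is thus a
signed relation among strict values attached to the rotations of one word.

That relation telescopes. Partial fractions applied to the factor 1/(n - m) in T give ε ζ(xvy) =
T(vs) - T(sv) for a letter s of sign ε (`sign_mul_zetaWord`). Around the cycle, the T of each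
rotation enters once with each sign (`evalStar_diamond_CBarWord`).

The subtraction needs T to be finite on every rotation (`cyclicTrace_ne_top`), and this is where
indices with all entries 1 drop out: already T(y) = ∞. If both letters occur, a rotation starting
with x converges because its kernel is at most 1/(n+1)² times powers of harmonic numbers, and the
other rotations follow from the identity for y. Working in ℝ≥0∞ makes the rearrangements free;
finiteness matters only on passing to differences.

For the weight, γ⁻¹ preserves the length of words, so every term of ρ̄₀(s_1⋯s_r) has length r + 1.
-/

namespace CyclicSum

open scoped ENNReal
open Filter Topology

/-! ### Reciprocals and harmonic numbers; the natural number `n` stands for the summation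
variable `n + 1`. -/

/-- `1 / (n + 1)` in `ℝ≥0∞`. -/
noncomputable def recip (n : ℕ) : ℝ≥0∞ := ENNReal.ofReal (1 / ((n : ℝ) + 1))

/-- The harmonic number `1 + 1/2 + ⋯ + 1/(n + 1)`. -/
noncomputable def harm (n : ℕ) : ℝ := ∑ i ∈ Finset.range (n + 1), 1 / ((i : ℝ) + 1)

theorem one_le_harm (n : ℕ) : 1 ≤ harm n := by
  rw [harm, Finset.sum_range_succ']
  simp only [Nat.cast_zero, zero_add, div_one, le_add_iff_nonneg_left]
  positivity

theorem harm_nonneg (n : ℕ) : 0 ≤ harm n := zero_le_one.trans (one_le_harm n)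

theorem harm_mono : Monotone harm := fun m n h =>
  Finset.sum_le_sum_of_subset_of_nonneg (Finset.range_subset_range.2 (by omega))
    fun i _ _ => by positivity

theorem ofReal_harm (n : ℕ) :
    ENNReal.ofReal (harm n) = ∑ i ∈ Finset.range (n + 1), recip i :=
  ENNReal.ofReal_sum_of_nonneg fun i _ => by positivity

theorem recip_le_one (n : ℕ) : recip n ≤ 1 := by
  rw [recip, ENNReal.ofReal_le_one, div_le_one (by positivity)]
  linarith [n.cast_nonneg (α := ℝ)]

theorem one_le_ofReal_harm (n : ℕ) : 1 ≤ ENNReal.ofReal (harm n) :=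
  ENNReal.one_le_ofReal.2 (one_le_harm n)

theorem harm_le_one_add_log (n : ℕ) : harm n ≤ 1 + Real.log ((n : ℝ) + 1) := by
  have h := harmonic_le_one_add_log (n + 1)
  simp only [harmonic, Rat.cast_sum, Rat.cast_inv] at h
  simpa [harm] using h

theorem harm_pow_le (k : ℕ) : ∃ c : ℝ, ∀ n : ℕ, harm n ^ k ≤ c * ((n : ℝ) + 1) ^ (1 / 2 : ℝ) := by
  -- The bound log t ≤ t^ε / ε, raised to the power k, costs t^(εk); keeping εk ≤ 1/2 leaves
  -- exponent -3/2 after two reciprocals.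
  obtain ⟨ε, hε, hk⟩ : ∃ ε : ℝ, 0 < ε ∧ ε * k ≤ 1 / 2 := by
    refine ⟨1 / (2 * (k + 1)), by positivity, ?_⟩
    rw [div_mul_eq_mul_div, div_le_div_iff₀ (by positivity) (by positivity)]
    linarith
  refine ⟨(1 + 1 / ε) ^ k, fun n => ?_⟩
  have hn : (1 : ℝ) ≤ (n : ℝ) + 1 := by linarith [n.cast_nonneg (α := ℝ)]
  have h1 : harm n ≤ (1 + 1 / ε) * ((n : ℝ) + 1) ^ ε := by
    have := Real.log_le_rpow_div (zero_le_one.trans hn) hε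
    have h2 := Real.one_le_rpow hn hε.le
    calc harm n ≤ 1 + Real.log ((n : ℝ) + 1) := harm_le_one_add_log n
      _ ≤ ((n : ℝ) + 1) ^ ε + ((n : ℝ) + 1) ^ ε / ε := add_le_add h2 this
      _ = _ := by ring
  calc harm n ^ k ≤ ((1 + 1 / ε) * ((n : ℝ) + 1) ^ ε) ^ k :=
        pow_le_pow_left₀ (harm_nonneg n) h1 k
    _ = (1 + 1 / ε) ^ k * ((n : ℝ) + 1) ^ (ε * k) := by
        rw [mul_pow, Real.rpow_mul (by positivity), Real.rpow_natCast]
    _ ≤ _ := by gcongr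

theorem summable_harm_pow (k : ℕ) :
    Summable fun n : ℕ => harm n ^ k * (1 / ((n : ℝ) + 1)) * (1 / ((n : ℝ) + 1)) := by
  obtain ⟨c, hc⟩ := harm_pow_le k
  have hs : Summable fun n : ℕ => c * (((n + 1 : ℕ) : ℝ) ^ (3 / 2 : ℝ))⁻¹ :=
    ((summable_nat_add_iff 1).2 (Real.summable_nat_rpow_inv.2 (by norm_num))).mul_left c
  refine hs.of_nonneg_of_le
    (fun n => by have := harm_nonneg n; positivity) fun n => ?_
  have hp : (0 : ℝ) < (n : ℝ) + 1 := by positivity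
  have h2 : ((n : ℝ) + 1) ^ (1 / 2 : ℝ) * (1 / ((n : ℝ) + 1)) * (1 / ((n : ℝ) + 1)) =
      (((n : ℝ) + 1) ^ (3 / 2 : ℝ))⁻¹ := by
    have h1 : 1 / ((n : ℝ) + 1) = ((n : ℝ) + 1) ^ (-1 : ℝ) := by rw [Real.rpow_neg_one, one_div]
    rw [← Real.rpow_neg hp.le, h1, ← Real.rpow_add hp, ← Real.rpow_add hp]
    norm_num
  rw [Nat.cast_add_one, ← h2, ← mul_assoc, ← mul_assoc]
  gcongr
  exact hc n

theorem tsum_harm_pow_ne_top (k : ℕ) :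
    ∑' n : ℕ, ENNReal.ofReal (harm n) ^ k * recip n * recip n ≠ ∞ := by
  have h := (summable_harm_pow k).tsum_ofReal_ne_top
  convert h using 3 with n
  have := harm_nonneg n
  rw [ENNReal.ofReal_mul (by positivity), ENNReal.ofReal_mul (by positivity),
    ENNReal.ofReal_pow this, recip]

/-! ### The kernel of a word -/

/-- The transfer kernel of a word: `x` divides by `n + 1`, and `y` divides by `n + 1` after
summing over all strictly smaller values. -/
noncomputable def kernel : List Letter → ℕ → ℕ → ℝ≥0∞
  | [], n, m => if n = m then 1 else 0
  | Letter.x :: w, n, m => recip n * kernel w n m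
  | Letter.y :: w, n, m => recip n * ∑ p ∈ Finset.range n, kernel w p m

/-- The kernel `1 / (n - m)`, supported on `m < n`. -/
noncomputable def gap (m n : ℕ) : ℝ≥0∞ :=
  if m < n then ENNReal.ofReal (1 / ((n : ℝ) - m)) else 0

/-- The sum `∑ K_w(n, m) / (n - m)` over `n > m`, where `K_w` is the kernel of `w`. -/
noncomputable def cyclicTrace (w : List Letter) : ℝ≥0∞ := ∑' n, ∑' m, kernel w n m * gap m n

/-- The multiple zeta value of the word `x w y`. -/
noncomputable def zetaWord (w : List Letter) : ℝ≥0∞ := ∑' n, ∑' m, recip n * kernel w n m * recip m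

theorem kernel_eq_zero_of_lt (w : List Letter) {n m : ℕ} (h : n < m) : kernel w n m = 0 := by
  induction w generalizing n with
  | nil => simp [kernel, h.ne]
  | cons s w ih =>
    cases s
    · simp [kernel, ih h]
    · rw [kernel, Finset.sum_eq_zero, mul_zero]
      exact fun p hp => ih ((Finset.mem_range.1 hp).trans h)

/-- A letter y forces a strict descent, which kills the diagonal n = m. `cyclicTrace_append_x` needs
this, since `gap` vanishes there but the summand of `zetaWord` need not. -/
theorem kernel_eq_zero_of_le {w : List Letter} (hw : Letter.y ∈ w) {n m : ℕ} (h : n ≤ m) :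
    kernel w n m = 0 := by
  induction w generalizing n with
  | nil => simp at hw
  | cons s w ih =>
    cases s
    · simp [kernel, ih (by simpa using hw) h]
    · rw [kernel, Finset.sum_eq_zero, mul_zero]
      exact fun p hp => kernel_eq_zero_of_lt w ((Finset.mem_range.1 hp).trans_le h)

theorem kernel_append_x (w : List Letter) (n m : ℕ) :
    kernel (w ++ [Letter.x]) n m = kernel w n m * recip m := by
  induction w generalizing n with
  | nil => by_cases h : n = m <;> simp [kernel, h]
  | cons s w ih =>
    cases s
    · simp [kernel, ih, mul_assoc]
    · simp [kernel, ih, mul_assoc, Finset.sum_mul]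

theorem kernel_append_y (w : List Letter) (n m : ℕ) :
    kernel (w ++ [Letter.y]) n m = ∑' p, kernel w n p * if m < p then recip p else 0 := by
  induction w generalizing n with
  | nil =>
    rw [tsum_eq_single n fun p hp => by simp [kernel, hp.symm]]
    by_cases h : m < n
    · simp [kernel, h]
    · simp [kernel, h]
  | cons s w ih =>
    cases s
    · simp only [List.cons_append, kernel, ih, mul_assoc, ENNReal.tsum_mul_left]
    · simp only [List.cons_append, kernel, ih, mul_assoc, ENNReal.tsum_mul_left, Finset.sum_mul]
      rw [Summable.tsum_finsetSum fun _ _ => ENNReal.summable]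

/-! ### Partial fractions -/

/-- Partial fractions for 1/((m+1)(n-m)), arranged without subtraction, which is truncated in ℝ≥0∞.
-/
theorem recip_mul_gap {m n : ℕ} (h : m < n) :
    recip m * gap m n = recip n * gap m n + recip n * recip m := by
  have h' : (0 : ℝ) < n - m := sub_pos.2 (Nat.cast_lt.2 h)
  rw [gap, if_pos h, recip, recip, ← ENNReal.ofReal_mul (by positivity),
    ← ENNReal.ofReal_mul (by positivity), ← ENNReal.ofReal_mul (by positivity),
    ← ENNReal.ofReal_add (by positivity) (by positivity)]
  congr 1
  field_simp
  ring

theorem cyclicTrace_append_x {w : List Letter} (hw : Letter.y ∈ w) :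
    cyclicTrace (w ++ [Letter.x]) = cyclicTrace (Letter.x :: w) + zetaWord w := by
  simp only [cyclicTrace, zetaWord, ← ENNReal.tsum_add]
  refine tsum_congr fun n => tsum_congr fun m => ?_
  rw [kernel_append_x, kernel]
  rcases lt_or_ge m n with h | h
  · rw [mul_assoc, recip_mul_gap h]
    ring
  · simp [kernel_eq_zero_of_le hw h]

/-- Telescoping with step k: only the first k values survive, because F tends to 0. -/
theorem hasSum_sub_shift {F : ℕ → ℝ} (hF : Antitone F) (h0 : Tendsto F atTop (𝓝 0)) (k : ℕ) :
    HasSum (fun i => F i - F (i + k)) (∑ j ∈ Finset.range k, F j) := by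
  induction k with
  | zero => simp
  | succ k ih =>
    have h1 : HasSum (fun i => F (i + k) - F (i + (k + 1))) (F k) := by
      rw [hasSum_iff_tendsto_nat_of_nonneg fun i => sub_nonneg.2 (hF (by omega))]
      have h2 : ∀ n, ∑ i ∈ Finset.range n, (F (i + k) - F (i + (k + 1))) = F k - F (n + k) := by
        intro n
        have := Finset.sum_range_sub' (fun i => F (i + k)) n
        simp only [zero_add] at this
        rw [← this]
        exact Finset.sum_congr rfl fun i _ => by rw [add_right_comm, add_assoc]
      simp only [h2]
      simpa using tendsto_const_nhds.sub ((tendsto_add_atTop_iff_nat k).2 h0)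
    rw [Finset.sum_range_succ]
    convert ih.add h1 using 2
    ring

/-- Since 1/((n+1)(n-m)) = (1/(n-m) - 1/(n+1))/(m+1), the series telescopes with step m + 1. Of the
m + 1 surviving terms, the last is 1/(a+1) and the others are 1/(a-b) for b < m. -/
theorem tsum_recip_mul_gap {a m : ℕ} (h : m ≤ a) :
    ∑' n, (if a < n then recip n * gap m n else 0) =
      recip m * recip a + recip m * ∑ b ∈ Finset.range m, gap b a := by
  have hma : (m : ℝ) ≤ a := Nat.cast_le.2 h
  -- With n = a + 1 + i, F i is 1/(n-m) and F (i + (m + 1)) is 1/(n+1).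
  set F : ℕ → ℝ := fun i => 1 / ((a : ℝ) + 1 + i - m) with hFdef
  have hpos : ∀ i : ℕ, (0 : ℝ) < (a : ℝ) + 1 + i - m := fun i => by
    linarith [i.cast_nonneg (α := ℝ)]
  have hanti : Antitone F := fun i j hij => by
    have : (i : ℝ) ≤ j := Nat.cast_le.2 hij
    exact one_div_le_one_div_of_le (hpos i) (by linarith)
  have h0 : Tendsto F atTop (𝓝 0) := by
    have h1 : Tendsto (fun i : ℕ => (a : ℝ) + 1 + i - m) atTop atTop := by
      have := tendsto_atTop_add_const_left atTop ((a : ℝ) + 1 - m)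
        (tendsto_natCast_atTop_atTop (R := ℝ))
      refine this.congr fun i => by ring
    simp only [hFdef, one_div]
    exact h1.inv_tendsto_atTop
  have hs := (hasSum_sub_shift hanti h0 (m + 1)).mul_left (1 / ((m : ℝ) + 1))
  have hterm : ∀ i : ℕ, 1 / ((m : ℝ) + 1) * (F i - F (i + (m + 1))) =
      1 / (((a + 1 + i : ℕ) : ℝ) + 1) * (1 / (((a + 1 + i : ℕ) : ℝ) - m)) := by
    intro i
    have h1 := hpos i
    simp only [hFdef]
    push_cast
    have h2 : (a : ℝ) + 1 + (i + (m + 1)) - m = a + 1 + i + 1 := by ring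
    rw [h2]
    field_simp
    ring
  simp only [hterm] at hs
  have hleft : ∑' n, (if a < n then recip n * gap m n else 0) =
      ∑' i : ℕ, recip (a + 1 + i) * gap m (a + 1 + i) := by
    rw [← ENNReal.summable.sum_add_tsum_nat_add' (k := a + 1), Finset.sum_eq_zero, zero_add]
    · refine tsum_congr fun i => ?_
      rw [if_pos (by omega), add_comm i]
    · intro i hi
      rw [if_neg]
      have := Finset.mem_range.1 hi
      omega
  have hright : recip m * recip a + recip m * ∑ b ∈ Finset.range m, gap b a =
      ENNReal.ofReal (1 / ((m : ℝ) + 1) * ∑ j ∈ Finset.range (m + 1), F j) := by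
    have hg : ∑ b ∈ Finset.range m, gap b a =
        ENNReal.ofReal (∑ b ∈ Finset.range m, 1 / ((a : ℝ) - b)) := by
      rw [ENNReal.ofReal_sum_of_nonneg]
      · refine Finset.sum_congr rfl fun b hb => ?_
        rw [gap, if_pos ((Finset.mem_range.1 hb).trans_le h)]
      · intro b hb
        have : (b : ℝ) < m := Nat.cast_lt.2 (Finset.mem_range.1 hb)
        exact one_div_nonneg.2 (by linarith)
    have hg0 : 0 ≤ ∑ b ∈ Finset.range m, 1 / ((a : ℝ) - b) := by
      refine Finset.sum_nonneg fun b hb => ?_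
      have : (b : ℝ) < m := Nat.cast_lt.2 (Finset.mem_range.1 hb)
      exact one_div_nonneg.2 (by linarith)
    rw [hg, ← mul_add, recip, recip, ← ENNReal.ofReal_add (by positivity) hg0,
      ← ENNReal.ofReal_mul (by positivity), Finset.sum_range_succ, ← Finset.sum_range_reflect F,
      add_comm (1 / ((a : ℝ) + 1))]
    congr 3
    · refine Finset.sum_congr rfl fun b hb => ?_
      have hb' := Finset.mem_range.1 hb
      simp only [hFdef]
      rw [show m - 1 - b = m - (1 + b) by omega, Nat.cast_sub (by omega)]
      push_cast
      congr 1
      ring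
    · simp [hFdef]
  rw [hleft, hright, ← hs.tsum_eq, ENNReal.ofReal_tsum_of_nonneg _ hs.summable]
  · refine tsum_congr fun i => ?_
    have : (0 : ℝ) < ((a + 1 + i : ℕ) : ℝ) - m := by
      push_cast
      linarith [i.cast_nonneg (α := ℝ)]
    rw [gap, if_pos (by omega), recip, ENNReal.ofReal_mul (by positivity)]
  · intro i
    have : (0 : ℝ) < ((a + 1 + i : ℕ) : ℝ) - m := by
      push_cast
      linarith [i.cast_nonneg (α := ℝ)]
    positivity

/-- Summing first over the variable of the leading y leaves the series of `tsum_recip_mul_gap`. Its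
term in `recip a` yields the zeta value; its sum over b < m is the variable created by a trailing y.
-/
theorem cyclicTrace_cons_y (w : List Letter) :
    cyclicTrace (Letter.y :: w) = cyclicTrace (w ++ [Letter.y]) + zetaWord w := by
  have h1 : cyclicTrace (Letter.y :: w) =
      ∑' p, ∑' m, kernel w p m * ∑' n, (if p < n then recip n * gap m n else 0) := by
    have h : ∀ n m, kernel (Letter.y :: w) n m * gap m n =
        ∑' p, kernel w p m * (if p < n then recip n * gap m n else 0) := by
      intro n m
      rw [kernel, tsum_eq_sum (s := Finset.range n), Finset.mul_sum, Finset.sum_mul]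
      · refine Finset.sum_congr rfl fun p hp => ?_
        rw [if_pos (Finset.mem_range.1 hp)]
        ring
      · intro p hp
        rw [if_neg (by simpa using hp), mul_zero]
    simp only [cyclicTrace, h, ← ENNReal.tsum_mul_left]
    calc _ = ∑' n, ∑' p, ∑' m, _ := tsum_congr fun n => ENNReal.tsum_comm
      _ = ∑' p, ∑' n, ∑' m, _ := ENNReal.tsum_comm
      _ = _ := tsum_congr fun p => ENNReal.tsum_comm
  have h2 : cyclicTrace (w ++ [Letter.y]) =
      ∑' p, ∑' m, kernel w p m * (recip m * ∑ b ∈ Finset.range m, gap b p) := by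
    simp only [cyclicTrace, kernel_append_y, ← ENNReal.tsum_mul_right]
    refine tsum_congr fun n => ?_
    rw [ENNReal.tsum_comm]
    refine tsum_congr fun p => ?_
    simp only [mul_assoc, ENNReal.tsum_mul_left]
    congr 1
    rw [tsum_eq_sum (s := Finset.range p), Finset.mul_sum]
    · refine Finset.sum_congr rfl fun b hb => ?_
      rw [if_pos (Finset.mem_range.1 hb)]
    · intro b hb
      rw [if_neg (by simpa using hb), zero_mul]
  rw [h1, h2, zetaWord]
  simp only [← ENNReal.tsum_add]
  refine tsum_congr fun n => tsum_congr fun m => ?_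
  rcases le_or_gt m n with h | h
  · rw [tsum_recip_mul_gap h]
    ring
  · simp [kernel_eq_zero_of_lt w h]

/-! ### Convergence -/

/-- Each y costs at most one harmonic number and each x a factor at most 1. The hypothesis excludes
the empty word, whose kernel has no factor 1/(n+1). -/
theorem kernel_le {w : List Letter} (hw : Letter.y ∈ w) (n m : ℕ) :
    kernel w n m ≤ ENNReal.ofReal (harm n) ^ w.length * recip n := by
  have hx : ∀ (v : List Letter) (p : ℕ), recip p * kernel v p m ≤ kernel v p m := fun v p =>
    mul_le_of_le_one_left' (recip_le_one p)
  induction w generalizing n with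
  | nil => simp at hw
  | cons s w ih =>
    cases s
    · have := ih (by simpa using hw) n
      refine (hx w n).trans (this.trans ?_)
      gcongr
      · exact one_le_ofReal_harm n
      · simp
    · rw [kernel, mul_comm, List.length_cons]
      gcongr
      by_cases hy : Letter.y ∈ w
      · calc ∑ p ∈ Finset.range n, kernel w p m
            ≤ ∑ p ∈ Finset.range n, ENNReal.ofReal (harm n) ^ w.length * recip p := by
              refine Finset.sum_le_sum fun p hp => (ih hy p).trans ?_
              gcongr
              exact harm_mono (Finset.mem_range.1 hp).le
          _ ≤ ENNReal.ofReal (harm n) ^ w.length * ENNReal.ofReal (harm n) := by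
              rw [← Finset.mul_sum, ofReal_harm]
              gcongr
              omega
          _ = _ := (pow_succ _ _).symm
      -- After the last y the kernel is dominated by the identity, so its sum over p is at most 1.
      · have hd : ∀ p, kernel w p m ≤ if p = m then 1 else 0 := by
          clear ih
          induction w with
          | nil => exact fun p => le_rfl
          | cons s w ih =>
            cases s
            · exact fun p => (hx w p).trans (ih (by simp) (by simpa using hy) p)
            · simp at hy
        calc ∑ p ∈ Finset.range n, kernel w p m ≤ ∑ p ∈ Finset.range n, if p = m then 1 else 0 :=
              Finset.sum_le_sum fun p _ => hd p
          _ ≤ 1 := by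
              rw [Finset.sum_ite_eq']
              split_ifs <;> simp
          _ ≤ _ := one_le_pow₀ (one_le_ofReal_harm n)

theorem tsum_gap_le (n : ℕ) : ∑' m, gap m n ≤ ENNReal.ofReal (harm n) := by
  rw [tsum_eq_sum (s := Finset.range n), ofReal_harm, ← Finset.sum_range_reflect,
    Finset.sum_range_succ]
  · refine le_add_right (Finset.sum_le_sum fun m hm => ?_)
    have h := Finset.mem_range.1 hm
    rw [gap, if_pos (by omega), recip, show n - 1 - m = n - (1 + m) by omega,
      Nat.cast_sub (by omega)]
    refine le_of_eq ?_
    push_cast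
    congr 2
    ring
  · intro m hm
    rw [gap, if_neg (by simpa using hm)]

/-- The leading x supplies the second factor 1/(n+1), and summing `gap` costs one more harmonic
number. -/
theorem cyclicTrace_cons_x_ne_top {w : List Letter} (hw : Letter.y ∈ w) :
    cyclicTrace (Letter.x :: w) ≠ ∞ := by
  refine ne_top_of_le_ne_top (tsum_harm_pow_ne_top (w.length + 1)) ?_
  refine ENNReal.tsum_le_tsum fun n => ?_
  calc ∑' m, kernel (Letter.x :: w) n m * gap m n
      ≤ ∑' m, recip n * (ENNReal.ofReal (harm n) ^ w.length * recip n) * gap m n := by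
        refine ENNReal.tsum_le_tsum fun m => ?_
        rw [kernel]
        gcongr
        exact kernel_le hw n m
    _ ≤ recip n * (ENNReal.ofReal (harm n) ^ w.length * recip n) * ENNReal.ofReal (harm n) := by
        rw [ENNReal.tsum_mul_left]
        gcongr
        exact tsum_gap_le n
    _ = _ := by ring

theorem tsum_kernel_mul_recip_le (w : List Letter) (n : ℕ) :
    ∑' m, kernel w n m * recip m ≤ ENNReal.ofReal (harm n) ^ w.length * recip n := by
  induction w generalizing n with
  | nil =>
    rw [tsum_eq_single n fun m hm => by simp [kernel, hm.symm]]
    simp [kernel]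
  | cons s w ih =>
    cases s
    · simp only [kernel, mul_assoc, ENNReal.tsum_mul_left]
      refine (mul_le_of_le_one_left' (recip_le_one n)).trans ((ih n).trans ?_)
      gcongr
      · exact one_le_ofReal_harm n
      · simp
    · simp only [kernel, mul_assoc, ENNReal.tsum_mul_left, Finset.sum_mul]
      rw [Summable.tsum_finsetSum fun _ _ => ENNReal.summable, mul_comm]
      gcongr
      calc ∑ p ∈ Finset.range n, ∑' m, kernel w p m * recip m
          ≤ ∑ p ∈ Finset.range n, ENNReal.ofReal (harm n) ^ w.length * recip p := by
            refine Finset.sum_le_sum fun p hp => (ih p).trans ?_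
            gcongr
            exact harm_mono (Finset.mem_range.1 hp).le
        _ ≤ ENNReal.ofReal (harm n) ^ w.length * ENNReal.ofReal (harm n) := by
            rw [← Finset.mul_sum, ofReal_harm]
            gcongr
            omega
        _ = _ := (pow_succ _ _).symm

theorem zetaWord_ne_top (w : List Letter) : zetaWord w ≠ ∞ := by
  refine ne_top_of_le_ne_top (tsum_harm_pow_ne_top w.length) ?_
  refine ENNReal.tsum_le_tsum fun n => ?_
  simp only [mul_assoc, ENNReal.tsum_mul_left]
  rw [mul_left_comm, ← mul_assoc, mul_comm (recip n), mul_comm (recip n)]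
  gcongr
  exact tsum_kernel_mul_recip_le w n

/-! ### Rotation of words -/

/-- A leading x converges outright; a leading y may be moved to the end at the price of a finite
zeta value. -/
theorem cyclicTrace_rotate_ne_top {s : Letter} {w : List Letter}
    (hy : Letter.y ∈ s :: w) (h : cyclicTrace (w ++ [s]) ≠ ∞) : cyclicTrace (s :: w) ≠ ∞ := by
  cases s
  · exact cyclicTrace_cons_x_ne_top (by simpa using hy)
  · rw [cyclicTrace_cons_y]
    exact ENNReal.add_ne_top.2 ⟨h, zetaWord_ne_top w⟩

theorem cyclicTrace_ne_top {w : List Letter} (hx : Letter.x ∈ w) (hy : Letter.y ∈ w) :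
    cyclicTrace w ≠ ∞ := by
  -- Cutting just before an x gives a rotation that starts with x; the letters of a are then moved
  -- back to the front one at a time.
  obtain ⟨a, b, rfl⟩ := List.append_of_mem hx
  have h : ∀ a b : List Letter, Letter.y ∈ a ++ b →
      cyclicTrace (b ++ a) ≠ ∞ → cyclicTrace (a ++ b) ≠ ∞ := by
    intro a
    induction a with
    | nil => simp
    | cons s a ih =>
      intro b hy hba
      refine cyclicTrace_rotate_ne_top hy ?_
      change cyclicTrace (a ++ b ++ [s]) ≠ ∞
      rw [List.append_assoc]
      refine ih (b ++ [s]) ?_ (by simpa using hba)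
      · simp only [List.mem_append, List.mem_cons, List.cons_append] at hy ⊢
        tauto
  refine h a _ hy (cyclicTrace_cons_x_ne_top (w := b ++ a) ?_)
  simp only [List.mem_append, List.mem_cons, reduceCtorEq, false_or] at hy ⊢
  tauto

/-- `1` for the letter `x` and `-1` for the letter `y`. -/
def sign : Letter → ℚ
  | Letter.x => 1
  | Letter.y => -1

theorem sign_mul_zetaWord {s : Letter} {w : List Letter} (hx : Letter.x ∈ s :: w)
    (hy : Letter.y ∈ s :: w) :
    (sign s : ℝ) * (zetaWord w).toReal =
      (cyclicTrace (w ++ [s])).toReal - (cyclicTrace (s :: w)).toReal := by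
  have h1 : cyclicTrace (s :: w) ≠ ∞ := cyclicTrace_ne_top hx hy
  have h2 : cyclicTrace (w ++ [s]) ≠ ∞ := by
    refine cyclicTrace_ne_top ?_ ?_ <;>
      simp only [List.mem_append, List.mem_cons, List.not_mem_nil, or_false] at hx hy ⊢ <;> tauto
  cases s
  · rw [cyclicTrace_append_x (by simpa using hy), ENNReal.toReal_add h1 (zetaWord_ne_top w)]
    simp [sign]
  · rw [cyclicTrace_cons_y, ENNReal.toReal_add h2 (zetaWord_ne_top w)]
    simp [sign]

/-! ### Nested sums -/

/-- The sum of `∏ 1 / (n_i + 1)^{k_i}` over `N ≥ n_1 ≥ ⋯ ≥ n_l ≥ 0`. -/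
noncomputable def nestedSum : List ℕ → ℕ → ℝ≥0∞
  | [], _ => 1
  | a :: k, N => ∑ n ∈ Finset.range (N + 1), recip n ^ a * nestedSum k n

theorem antitone_cons {l : ℕ} {a : ℕ} {t : Fin l → ℕ} :
    Antitone (Fin.cons a t : Fin (l + 1) → ℕ) ↔ Antitone t ∧ ∀ i, t i ≤ a := by
  constructor
  · intro h
    exact ⟨fun i j hij => by simpa using h (Fin.succ_le_succ_iff.2 hij),
      fun i => by simpa using h (Fin.zero_le i.succ)⟩
  · rintro ⟨h1, h2⟩ i j hij
    induction i using Fin.cases with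
    | zero =>
      induction j using Fin.cases with
      | zero => exact le_rfl
      | succ j => simpa using h2 j
    | succ i =>
      induction j using Fin.cases with
      | zero => simp at hij
      | succ j => simpa using h1 (Fin.succ_le_succ_iff.1 hij)

theorem tsum_cons {l : ℕ} (F : (Fin (l + 1) → ℕ) → ℝ≥0∞) :
    ∑' n, F n = ∑' a, ∑' t, F (Fin.cons a t) := by
  rw [← (Fin.consEquiv fun _ : Fin (l + 1) => ℕ).tsum_eq, ENNReal.tsum_prod']
  rfl

-- The bound N is what makes the recursion close: once the largest variable is fixed, it bounds the
-- remaining ones.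
open Classical in
theorem tsum_bounded_eq_nestedSum (k : List ℕ) (N : ℕ) :
    ∑' n : Fin k.length → ℕ,
      (if Antitone n ∧ ∀ i, n i ≤ N then ∏ i, recip (n i) ^ k.get i else 0) = nestedSum k N := by
  induction k generalizing N with
  | nil =>
    have h : ∀ n : Fin ([] : List ℕ).length → ℕ, Antitone n := fun n i => i.elim0
    rw [tsum_eq_single (fun i => i.elim0) fun n hn => absurd (funext fun i => i.elim0) hn,
      if_pos ⟨h _, fun i => i.elim0⟩]
    exact Fin.prod_univ_zero _
  | cons a k ih =>
    refine (tsum_cons (l := k.length) _).trans ?_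
    rw [nestedSum, tsum_eq_sum (s := Finset.range (N + 1))]
    · refine Finset.sum_congr rfl fun M hM => ?_
      rw [← ih, ← ENNReal.tsum_mul_left]
      refine tsum_congr fun t => ?_
      have hM' : M ≤ N := Nat.lt_succ_iff.1 (Finset.mem_range.1 hM)
      have hiff : (Antitone (Fin.cons M t : Fin (k.length + 1) → ℕ) ∧
          ∀ i, (Fin.cons M t : Fin (k.length + 1) → ℕ) i ≤ N) ↔ (Antitone t ∧ ∀ i, t i ≤ M) := by
        rw [antitone_cons]
        refine ⟨fun h => h.1, fun h => ⟨h, fun i => ?_⟩⟩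
        induction i using Fin.cases with
        | zero => exact hM'
        | succ i => exact (h.2 i).trans hM'
      by_cases hc : Antitone t ∧ ∀ i, t i ≤ M
      · rw [if_pos hc]
        refine (if_pos (hiff.2 hc)).trans ?_
        exact Fin.prod_univ_succ (n := k.length) _
      · rw [if_neg hc, mul_zero]
        exact if_neg (mt hiff.1 hc)
    · intro M hM
      refine ENNReal.tsum_eq_zero.2 fun t => if_neg fun h => hM ?_
      exact Finset.mem_range.2 (Nat.lt_succ_of_le (h.2 (0 : Fin (k.length + 1))))

open Classical in
theorem zetaStar_eq_tsum (k : List ℕ) :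
    zetaStar k = (∑' n : Fin k.length → ℕ,
      if Antitone n then ∏ i, recip (n i) ^ k.get i else 0).toReal := by
  have h1 : ∀ n : Fin k.length → ℕ, ∏ i, recip (n i) ^ k.get i =
      ENNReal.ofReal (∏ i, 1 / ((n i : ℝ) + 1) ^ k.get i) := by
    intro n
    rw [ENNReal.ofReal_prod_of_nonneg fun i _ => by positivity]
    refine Finset.prod_congr rfl fun i _ => ?_
    rw [recip, ← ENNReal.ofReal_pow (by positivity), one_div_pow]
  have h2 : ∑' n : Fin k.length → ℕ, (if Antitone n then ∏ i, recip (n i) ^ k.get i else 0) =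
      ∑' n : {n : Fin k.length → ℕ // Antitone n}, ∏ i, recip (n.1 i) ^ k.get i := by
    refine (tsum_subtype {n : Fin k.length → ℕ | Antitone n}
      fun n => ∏ i, recip (n i) ^ k.get i).symm ▸ ?_
    refine tsum_congr fun n => ?_
    simp [Set.indicator]
  let e : {n : Fin k.length → ℕ // Antitone n} ≃ {n : Fin k.length → ℕ+ // Antitone n} :=
    (Equiv.arrowCongr (Equiv.refl _) OrderIso.pnatIsoNat.symm.toEquiv).subtypeEquiv fun n =>
      ⟨fun h => OrderIso.pnatIsoNat.symm.monotone.comp_antitone h,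
        fun h i j hij => OrderIso.pnatIsoNat.symm.le_iff_le.1 (h hij)⟩
  -- No convergence is needed: a divergent series gives 0 on both sides.
  rw [h2, ENNReal.tsum_toReal_eq, zetaStar, ← e.tsum_eq]
  · refine tsum_congr fun n => ?_
    rw [h1, ENNReal.toReal_ofReal (Finset.prod_nonneg fun i _ => by positivity)]
    refine Finset.prod_congr rfl fun i _ => ?_
    have : (((e n).1 i : ℕ) : ℝ) = (n.1 i : ℝ) + 1 := by
      change ((Nat.succPNat (n.1 i) : ℕ) : ℝ) = _
      simp
    rw [this]
  · intro n
    rw [h1]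
    exact ENNReal.ofReal_ne_top

theorem zetaStar_cons (a : ℕ) (k : List ℕ) :
    zetaStar (a :: k) = (∑' n, recip n ^ a * nestedSum k n).toReal := by
  classical
  rw [zetaStar_eq_tsum]
  congr 1
  refine (tsum_cons (l := k.length) _).trans ?_
  refine tsum_congr fun M => ?_
  rw [← tsum_bounded_eq_nestedSum, ← ENNReal.tsum_mul_left]
  refine tsum_congr fun t => ?_
  by_cases hc : Antitone t ∧ ∀ i, t i ≤ M
  · rw [if_pos hc]
    refine (if_pos (antitone_cons.2 hc)).trans ?_
    exact Fin.prod_univ_succ (n := k.length) _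
  · rw [if_neg hc, mul_zero]
    exact if_neg (mt antitone_cons.1 hc)

/-! ### Two representations of Hoffman's algebra on sequences -/

/-- Division by `n + 1`. -/
noncomputable def opX : Module.End ℚ (ℕ → ℝ) where
  toFun f n := 1 / ((n : ℝ) + 1) * f n
  map_add' f g := by ext n; simp [mul_add]
  map_smul' c f := by ext n; simp

/-- Division by `n + 1` after summation over strictly smaller arguments. -/
noncomputable def opY : Module.End ℚ (ℕ → ℝ) where
  toFun f n := 1 / ((n : ℝ) + 1) * ∑ m ∈ Finset.range n, f m
  map_add' f g := by ext n; simp [mul_add, Finset.sum_add_distrib]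
  map_smul' c f := by ext n; simp [← Finset.smul_sum]

theorem opX_apply (f : ℕ → ℝ) (n : ℕ) : opX f n = 1 / ((n : ℝ) + 1) * f n := rfl

theorem opY_apply (f : ℕ → ℝ) (n : ℕ) :
    opY f n = 1 / ((n : ℝ) + 1) * ∑ m ∈ Finset.range n, f m := rfl

theorem opX_add_opY_apply (f : ℕ → ℝ) (n : ℕ) :
    (opX + opY) f n = 1 / ((n : ℝ) + 1) * ∑ m ∈ Finset.range (n + 1), f m := by
  rw [LinearMap.add_apply, Pi.add_apply, opX_apply, opY_apply, Finset.sum_range_succ]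
  ring

/-- The representation attached to sums over strictly decreasing sequences. -/
noncomputable def strictRep : H →ₐ[ℚ] Module.End ℚ (ℕ → ℝ) :=
  FreeAlgebra.lift ℚ fun | Letter.x => opX | Letter.y => opY

/-- The representation attached to sums over weakly decreasing sequences. -/
noncomputable def starRep : H →ₐ[ℚ] Module.End ℚ (ℕ → ℝ) :=
  FreeAlgebra.lift ℚ fun | Letter.x => opX | Letter.y => opX + opY

/-- The sequence `1 / (n + 1)`. -/
noncomputable def recipSeq (n : ℕ) : ℝ := 1 / ((n : ℝ) + 1)

/-- The product of the letters of a word. -/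
noncomputable def wordProd (w : List Letter) : H := (w.map (FreeAlgebra.ι ℚ)).prod

theorem wordProd_nil : wordProd [] = 1 := rfl

theorem wordProd_cons (s : Letter) (w : List Letter) :
    wordProd (s :: w) = FreeAlgebra.ι ℚ s * wordProd w := by simp [wordProd]

theorem wordProd_append (v w : List Letter) : wordProd (v ++ w) = wordProd v * wordProd w := by
  simp [wordProd]

theorem wordProd_singleton (s : Letter) : wordProd [s] = FreeAlgebra.ι ℚ s := by simp [wordProd]

theorem span_range_wordProd : Submodule.span ℚ (Set.range wordProd) = ⊤ := by
  rw [← wordBasis.span_eq]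
  congr 1
  ext v
  constructor
  · rintro ⟨w, rfl⟩
    exact ⟨FreeMonoid.ofList w, wordBasis_apply _⟩
  · rintro ⟨w, rfl⟩
    exact ⟨w.toList, (wordBasis_apply w).symm⟩

theorem gamma_symm_x : gamma.symm x = x := by simp [gamma, x]

theorem gamma_symm_y : gamma.symm y = y - x := by simp [gamma, y]

/-- On letters, y - x acts in the star representation as (opX + opY) - opX = opY. -/
theorem starRep_gamma_symm (w : H) : starRep (gamma.symm w) = strictRep w := by
  have h : starRep.comp (gamma.symm : H →ₐ[ℚ] H) = strictRep := by
    ext1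
    funext s
    cases s
    · change starRep (gamma.symm x) = strictRep x
      rw [gamma_symm_x]
      simp [starRep, strictRep, x]
    · change starRep (gamma.symm y) = strictRep y
      rw [gamma_symm_y]
      simp [starRep, strictRep, x, y]
  exact DFunLike.congr_fun h w

theorem starRep_x_cons (w : List Letter) (f : ℕ → ℝ) :
    starRep (wordProd (Letter.x :: w)) f = opX (starRep (wordProd w) f) := by
  rw [wordProd_cons, map_mul]
  simp [starRep]

theorem starRep_y_cons (w : List Letter) (f : ℕ → ℝ) :
    starRep (wordProd (Letter.y :: w)) f = (opX + opY) (starRep (wordProd w) f) := by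
  rw [wordProd_cons, map_mul]
  simp [starRep]

theorem strictRep_x_cons (w : List Letter) (f : ℕ → ℝ) :
    strictRep (wordProd (Letter.x :: w)) f = opX (strictRep (wordProd w) f) := by
  rw [wordProd_cons, map_mul]
  simp [strictRep]

theorem strictRep_y_cons (w : List Letter) (f : ℕ → ℝ) :
    strictRep (wordProd (Letter.y :: w)) f = opY (strictRep (wordProd w) f) := by
  rw [wordProd_cons, map_mul]
  simp [strictRep]

theorem starRep_wordProd_nonneg (w : List Letter) (n : ℕ) :
    0 ≤ starRep (wordProd w) recipSeq n := by
  induction w generalizing n with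
  | nil =>
    simp only [wordProd_nil, map_one, Module.End.one_apply, recipSeq]
    positivity
  | cons s w ih =>
    cases s
    · rw [starRep_x_cons, opX_apply]
      exact mul_nonneg (by positivity) (ih n)
    · rw [starRep_y_cons, opX_add_opY_apply]
      exact mul_nonneg (by positivity) (Finset.sum_nonneg fun m _ => ih m)

theorem strictRep_wordProd_nonneg (w : List Letter) (n : ℕ) :
    0 ≤ strictRep (wordProd w) recipSeq n := by
  induction w generalizing n with
  | nil =>
    simp only [wordProd_nil, map_one, Module.End.one_apply, recipSeq]
    positivity
  | cons s w ih =>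
    cases s
    · rw [strictRep_x_cons, opX_apply]
      exact mul_nonneg (by positivity) (ih n)
    · rw [strictRep_y_cons, opY_apply]
      exact mul_nonneg (by positivity) (Finset.sum_nonneg fun m _ => ih m)

theorem starRep_wordProd_le (w : List Letter) (n : ℕ) :
    starRep (wordProd w) recipSeq n ≤ harm n ^ w.length * (1 / ((n : ℝ) + 1)) := by
  induction w generalizing n with
  | nil => simp [wordProd_nil, recipSeq]
  | cons s w ih =>
    have hn := harm_nonneg n
    cases s
    · rw [starRep_x_cons, opX_apply]
      have h1 : 1 / ((n : ℝ) + 1) ≤ 1 := by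
        rw [div_le_one (by positivity)]
        linarith [n.cast_nonneg (α := ℝ)]
      calc _ ≤ starRep (wordProd w) recipSeq n :=
            mul_le_of_le_one_left (starRep_wordProd_nonneg w n) h1
        _ ≤ _ := ih n
        _ ≤ _ := by
          gcongr
          · exact one_le_harm n
          · simp
    · rw [starRep_y_cons, opX_add_opY_apply, mul_comm]
      gcongr
      calc ∑ m ∈ Finset.range (n + 1), starRep (wordProd w) recipSeq m
          ≤ ∑ m ∈ Finset.range (n + 1), harm n ^ w.length * (1 / ((m : ℝ) + 1)) := by
            refine Finset.sum_le_sum fun m hm => (ih m).trans ?_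
            have := harm_nonneg m
            gcongr
            exact harm_mono (Nat.lt_succ_iff.1 (Finset.mem_range.1 hm))
        _ = _ := by rw [← Finset.mul_sum, List.length_cons, pow_succ, harm]

theorem summable_starRep_wordProd (w : List Letter) :
    Summable fun n : ℕ => 1 / ((n : ℝ) + 1) * starRep (wordProd w) recipSeq n := by
  refine (summable_harm_pow w.length).of_nonneg_of_le
    (fun n => mul_nonneg (by positivity) (starRep_wordProd_nonneg w n)) fun n => ?_
  rw [mul_comm]
  gcongr
  exact starRep_wordProd_le w n

/-! ### The evaluation map on `x w y` -/

/-- The accumulator c is the power of 1/(n+1) already collected from letters x. The final y is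
carried by `recipSeq`. -/
theorem exists_wordIndexAux (w : List Letter) (c : ℕ) :
    ∃ a k, wordIndexAux c (w ++ [Letter.y]) = a :: k ∧ ∀ n : ℕ,
      recip n ^ c * ENNReal.ofReal (starRep (wordProd w) recipSeq n) =
        recip n ^ a * nestedSum k n := by
  induction w generalizing c with
  | nil =>
    refine ⟨c + 1, [], rfl, fun n => ?_⟩
    simp [wordProd_nil, nestedSum, recipSeq, recip, pow_succ]
  | cons s w ih =>
    cases s
    · obtain ⟨a, k, h1, h2⟩ := ih (c + 1)
      refine ⟨a, k, h1, fun n => ?_⟩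
      rw [← h2, starRep_x_cons, opX_apply, ENNReal.ofReal_mul (by positivity), pow_succ, mul_assoc,
        recip]
    · obtain ⟨a, k, h1, h2⟩ := ih 0
      refine ⟨c + 1, a :: k, congrArg _ h1, fun n => ?_⟩
      rw [starRep_y_cons, opX_add_opY_apply, ENNReal.ofReal_mul (by positivity), pow_succ,
        mul_assoc, nestedSum, ENNReal.ofReal_sum_of_nonneg fun m _ => starRep_wordProd_nonneg w m,
        recip]
      simp only [← h2, pow_zero, one_mul]

/-- `Z̄` extended to all words. -/
noncomputable def evalStar : H →ₗ[ℚ] ℝ := wordBasis.constr ℚ fun w => zetaStar (wordIndex w)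

theorem evalStar_wordProd (w : List Letter) :
    evalStar (wordProd w) = zetaStar (wordIndexAux 0 w) := by
  have hb := wordBasis_apply (FreeMonoid.ofList w)
  rw [FreeMonoid.toList_ofList] at hb
  rw [evalStar, wordProd, ← hb, Module.Basis.constr_basis, wordIndex, FreeMonoid.toList_ofList]

/-- Stated for all v so that it applies to γ⁻¹ of a word, a signed combination of words. `HasSum`
passes to such combinations by linearity. -/
theorem hasSum_evalStar (v : H) :
    HasSum (fun n : ℕ => 1 / ((n : ℝ) + 1) * starRep v recipSeq n) (evalStar (x * v * y)) := by
  have hv : v ∈ Submodule.span ℚ (Set.range wordProd) := by simp [span_range_wordProd]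
  induction hv using Submodule.span_induction with
  | zero => simp
  | add v w _ _ h h' =>
    simpa [mul_add, add_mul] using h.add h'
  | smul c v _ h =>
    have := h.const_smul c
    simpa [mul_smul_comm, smul_mul_assoc] using this
  | mem v hv =>
    obtain ⟨w, rfl⟩ := hv
    have hxy : x * wordProd w * y = wordProd (Letter.x :: w ++ [Letter.y]) := by
      rw [wordProd_append, wordProd_cons, wordProd_singleton, x, y]
    have hs := summable_starRep_wordProd w
    obtain ⟨a, k, h1, h2⟩ := exists_wordIndexAux (Letter.x :: w) 0
    rw [hxy, evalStar_wordProd, h1, zetaStar_cons]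
    simp only [← h2, starRep_x_cons, opX_apply, pow_zero, one_mul]
    rw [← ENNReal.ofReal_tsum_of_nonneg
      (fun n => mul_nonneg (by positivity) (starRep_wordProd_nonneg w n)) hs,
      ENNReal.toReal_ofReal
        (tsum_nonneg fun n => mul_nonneg (by positivity) (starRep_wordProd_nonneg w n))]
    exact hs.hasSum

theorem ofReal_strictRep_wordProd (w : List Letter) (n : ℕ) :
    ENNReal.ofReal (strictRep (wordProd w) recipSeq n) = ∑' m, kernel w n m * recip m := by
  induction w generalizing n with
  | nil =>
    rw [tsum_eq_single n fun m hm => by simp [kernel, hm.symm]]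
    simp [wordProd_nil, kernel, recip, recipSeq]
  | cons s w ih =>
    cases s
    · rw [strictRep_x_cons, opX_apply, ENNReal.ofReal_mul (by positivity), ih]
      simp only [kernel, mul_assoc, ENNReal.tsum_mul_left, recip]
    · rw [strictRep_y_cons, opY_apply, ENNReal.ofReal_mul (by positivity),
        ENNReal.ofReal_sum_of_nonneg fun m _ => strictRep_wordProd_nonneg w m]
      simp only [kernel, mul_assoc, ENNReal.tsum_mul_left, Finset.sum_mul, ih]
      rw [Summable.tsum_finsetSum fun _ _ => ENNReal.summable, recip]

theorem evalStar_gamma_symm (w : List Letter) :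
    evalStar (x * gamma.symm (wordProd w) * y) = (zetaWord w).toReal := by
  have h := hasSum_evalStar (gamma.symm (wordProd w))
  simp only [starRep_gamma_symm] at h
  have hn : ∀ n : ℕ, 0 ≤ 1 / ((n : ℝ) + 1) * strictRep (wordProd w) recipSeq n := fun n =>
    mul_nonneg (by positivity) (strictRep_wordProd_nonneg w n)
  rw [← h.tsum_eq, ← ENNReal.toReal_ofReal (tsum_nonneg hn),
    ENNReal.ofReal_tsum_of_nonneg hn h.summable, zetaWord]
  congr 1
  refine tsum_congr fun n => ?_
  rw [ENNReal.ofReal_mul (by positivity), ofReal_strictRep_wordProd]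
  simp only [mul_assoc, ENNReal.tsum_mul_left, recip]

/-! ### The operator on words -/

theorem mul'_diamond_CBarLetter (a b : H) (s : Letter) :
    LinearMap.mul' ℚ H (diamond a (CBarLetter s) b) = sign s • (x * (b * a) * y) := by
  cases s <;> simp [diamond, CBarLetter, sign, mul_assoc]

theorem mul'_diamond_CBarWord_cons (a : List Letter) (s : Letter) (w : List Letter) :
    LinearMap.mul' ℚ H (diamond (gamma.symm (wordProd a)) (CBarWord (s :: w)) 1) =
      sign s • (x * gamma.symm (wordProd (w ++ a)) * y) +
        LinearMap.mul' ℚ H (diamond (gamma.symm (wordProd (a ++ [s]))) (CBarWord w) 1) := by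
  rw [CBarWord, diamond_add, diamond_diamond, diamond_diamond, map_add, mul_one, mul_one, mul_one,
    mul'_diamond_CBarLetter, ← map_mul, ← map_mul, wordProd_append, wordProd_append,
    wordProd_singleton]
  rfl

/-- Here a is the part of the word already read and w the part still to be read. Reading one letter
contributes one difference of consecutive rotations, so the sum telescopes; for a = [] the two ends
coincide. -/
theorem evalStar_diamond_CBarWord (a w : List Letter) (hx : Letter.x ∈ w ++ a)
    (hy : Letter.y ∈ w ++ a) :
    evalStar (LinearMap.mul' ℚ H (diamond (gamma.symm (wordProd a)) (CBarWord w) 1)) =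
      (cyclicTrace (a ++ w)).toReal - (cyclicTrace (w ++ a)).toReal := by
  induction w generalizing a with
  | nil => simp [CBarWord, diamond_zero]
  | cons s w ih =>
    rw [mul'_diamond_CBarWord_cons, map_add, map_smul, evalStar_gamma_symm, Rat.smul_def,
      sign_mul_zetaWord (w := w ++ a) hx hy, ih]
    · simp
    · simp only [List.mem_append, List.mem_cons, List.cons_append] at hx ⊢
      tauto
    · simp only [List.mem_append, List.mem_cons, List.cons_append] at hy ⊢
      tauto

theorem rhoBar_wordProd (w : List Letter) :
    rhoBar (wordProd w) =
      LinearMap.mul' ℚ H (diamond (gamma.symm (wordProd [])) (CBarWord w) 1) := by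
  rw [rhoBar, LinearMap.comp_apply, wordProd, CBar_prod, wordProd_nil, map_one]
  simp [diamond]

theorem evalStar_rhoBar_wordProd {w : List Letter} (hx : Letter.x ∈ w) (hy : Letter.y ∈ w) :
    evalStar (rhoBar (wordProd w)) = 0 := by
  rw [rhoBar_wordProd, evalStar_diamond_CBarWord] <;> simp [hx, hy]

/-! ### Weights -/

theorem wordProd_append_y (w : List Letter) (c : ℕ) :
    ∃ a k, 1 ≤ a ∧ (∀ b ∈ k, 1 ≤ b) ∧ a + k.sum = w.length + 1 ∧
      x ^ c * (wordProd w * y) = zProd ((c + a) :: k) := by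
  induction w generalizing c with
  | nil => exact ⟨1, [], le_rfl, by simp, by simp, by simp [wordProd_nil, zProd, z]⟩
  | cons s w ih =>
    cases s
    · obtain ⟨a, k, ha, hk, hs, h⟩ := ih (c + 1)
      refine ⟨a + 1, k, by omega, hk, by simp; omega, ?_⟩
      rw [← add_assoc, add_right_comm, ← h, wordProd_cons, pow_succ, x]
      simp only [mul_assoc]
    · obtain ⟨a, k, ha, hk, hs, h⟩ := ih 0
      refine ⟨1, a :: k, le_rfl, by simpa using ⟨ha, hk⟩, by simp; omega, ?_⟩
      rw [pow_zero, one_mul, zero_add] at h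
      have h2 : zProd ((c + 1) :: a :: k) = z (c + 1) * zProd (a :: k) := by simp [zProd]
      rw [h2, ← h, wordProd_cons, z, y, Nat.add_sub_cancel]
      simp only [mul_assoc]

theorem x_mul_wordProd_mul_y_mem (w : List Letter) :
    x * wordProd w * y ∈ HZeroWeight (w.length + 2) := by
  obtain ⟨a, k, ha, hk, hs, h⟩ := wordProd_append_y w 1
  rw [mul_assoc, ← pow_one x, h]
  refine Submodule.subset_span ⟨_, ⟨⟨⟨by simp, ?_⟩, 1 + a, by simp, by omega⟩, ?_⟩, rfl⟩
  · simpa using hk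
  · simp only [List.sum_cons]
    omega

/-- γ⁻¹ sends each letter to a combination of letters, hence is homogeneous for length. -/
theorem gamma_symm_wordProd_mem (w : List Letter) :
    gamma.symm (wordProd w) ∈ Submodule.span ℚ (wordProd '' {v | v.length = w.length}) := by
  have hmul : ∀ (s : Letter) (n : ℕ) (v : H),
      v ∈ Submodule.span ℚ (wordProd '' {v | v.length = n}) →
      FreeAlgebra.ι ℚ s * v ∈ Submodule.span ℚ (wordProd '' {v | v.length = n + 1}) := by
    intro s n v hv
    induction hv using Submodule.span_induction with
    | zero => simp
    | add v w _ _ h h' => rw [mul_add]; exact add_mem h h'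
    | smul c v _ h => rw [mul_smul_comm]; exact Submodule.smul_mem _ c h
    | mem v hv =>
      obtain ⟨v, hv, rfl⟩ := hv
      rw [← wordProd_cons]
      exact Submodule.subset_span ⟨_, by simpa using hv, rfl⟩
  induction w with
  | nil => exact Submodule.subset_span ⟨[], rfl, by simp [wordProd_nil]⟩
  | cons s w ih =>
    rw [wordProd_cons, map_mul]
    cases s
    · change gamma.symm x * _ ∈ _
      rw [gamma_symm_x]
      exact hmul Letter.x _ _ ih
    · change gamma.symm y * _ ∈ _
      rw [gamma_symm_y, sub_mul]
      exact sub_mem (hmul Letter.y _ _ ih) (hmul Letter.x _ _ ih)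

theorem x_mul_gamma_symm_mul_y_mem (w : List Letter) :
    x * gamma.symm (wordProd w) * y ∈ HZeroWeight (w.length + 2) := by
  have h := gamma_symm_wordProd_mem w
  generalize gamma.symm (wordProd w) = u at h
  induction h using Submodule.span_induction with
  | zero => simp
  | add v w _ _ h h' => rw [mul_add, add_mul]; exact add_mem h h'
  | smul c v _ h => rw [mul_smul_comm, smul_mul_assoc]; exact Submodule.smul_mem _ c h
  | mem v hv =>
    obtain ⟨v, hv, rfl⟩ := hv
    rw [← show v.length = w.length from hv]
    exact x_mul_wordProd_mul_y_mem v

theorem diamond_CBarWord_mem (a w : List Letter) :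
    LinearMap.mul' ℚ H (diamond (gamma.symm (wordProd a)) (CBarWord w) 1) ∈
      HZeroWeight ((w ++ a).length + 1) := by
  induction w generalizing a with
  | nil => simp [CBarWord, diamond_zero]
  | cons s w ih =>
    rw [mul'_diamond_CBarWord_cons]
    refine add_mem (Submodule.smul_mem _ _ (x_mul_gamma_symm_mul_y_mem (w ++ a))) ?_
    have h := ih (a ++ [s])
    rwa [show (w ++ (a ++ [s])).length = (s :: w ++ a).length by simp; omega] at h

theorem rhoBar_wordProd_mem (w : List Letter) :
    rhoBar (wordProd w) ∈ HZeroWeight (w.length + 1) := by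
  have h := diamond_CBarWord_mem [] w
  rwa [← rhoBar_wordProd, List.append_nil] at h

theorem HZeroWeight_le (k : ℕ) : HZeroWeight k ≤ HZero := by
  refine Submodule.span_le.2 ?_
  rintro _ ⟨i, hi, rfl⟩
  exact zProd_mem_HZero hi.1

/-- The word `z_{k_1} ⋯ z_{k_l}`. -/
def indexWord : List ℕ → List Letter
  | [] => []
  | a :: k => List.replicate (a - 1) Letter.x ++ Letter.y :: indexWord k

theorem wordProd_indexWord (k : List ℕ) : wordProd (indexWord k) = zProd k := by
  induction k with
  | nil => rfl
  | cons a k ih =>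
    have h : zProd (a :: k) = z a * zProd k := by simp [zProd]
    rw [h, ← ih, indexWord, wordProd_append, wordProd_cons, z, x, y]
    simp [wordProd, mul_assoc]

theorem length_indexWord {k : List ℕ} (hk : ∀ a ∈ k, 1 ≤ a) : (indexWord k).length = k.sum := by
  induction k with
  | nil => rfl
  | cons a k ih =>
    have h1 := hk a List.mem_cons_self
    have h2 := ih fun b hb => hk b (List.mem_cons_of_mem _ hb)
    simp only [indexWord, List.length_append, List.length_replicate, List.length_cons, h2,
      List.sum_cons]
    omega

theorem y_mem_indexWord {k : List ℕ} (hk : k ≠ []) : Letter.y ∈ indexWord k := by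
  cases k with
  | nil => exact absurd rfl hk
  | cons a k => simp [indexWord]

theorem x_mem_indexWord {k : List ℕ} {a : ℕ} (ha : a ∈ k) (h2 : 2 ≤ a) :
    Letter.x ∈ indexWord k := by
  induction k with
  | nil => simp at ha
  | cons b k ih =>
    rw [indexWord, List.mem_append, List.mem_cons, List.mem_replicate]
    rcases List.mem_cons.1 ha with rfl | h
    · exact Or.inl ⟨by omega, rfl⟩
    · exact Or.inr (Or.inr (ih h))

/-! ### The operator on monomials with an entry at least 2 -/

theorem rhoBar_zProd_mem_ker {k : List ℕ} (hk : k ∈ indexCheck) :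
    rhoBar (zProd k) ∈ (LinearMap.ker ZBar).map HZero.subtype := by
  obtain ⟨⟨hne, hpos⟩, hone⟩ := hk
  push Not at hone
  obtain ⟨a, ha, h1⟩ := hone
  have h2 : 2 ≤ a := by
    have := hpos a ha
    omega
  rw [← wordProd_indexWord]
  refine ⟨⟨_, HZeroWeight_le _ (rhoBar_wordProd_mem (indexWord k))⟩, ?_, rfl⟩
  -- `ZBar` is by definition the restriction of `evalStar`; the entry a ≥ 2 provides the letter x.
  exact evalStar_rhoBar_wordProd (x_mem_indexWord ha h2) (y_mem_indexWord hne)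

theorem rhoBar_zProd_mem_weight {k : List ℕ} (hk : k ∈ indexCheck) :
    rhoBar (zProd k) ∈ HZeroWeight (k.sum + 1) := by
  rw [← wordProd_indexWord, ← length_indexWord hk.1.2]
  exact rhoBar_wordProd_mem _

end CyclicSum

theorem mainTheorem7 :
    Submodule.map CyclicSum.rhoBar CyclicSum.HCheck ≤
        (LinearMap.ker CyclicSum.ZBar).map CyclicSum.HZero.subtype ∧
      ∀ k : ℕ, 2 ≤ k →
        Submodule.map CyclicSum.rhoBar (CyclicSum.HCheckWeight (k - 1)) ≤
          (LinearMap.ker CyclicSum.ZBar).map CyclicSum.HZero.subtype ⊓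
            CyclicSum.HZeroWeight k := by
  constructor
  · rw [CyclicSum.HCheck, Submodule.map_span_le]
    rintro _ ⟨i, hi, rfl⟩
    exact CyclicSum.rhoBar_zProd_mem_ker hi
  · intro k hk
    rw [CyclicSum.HCheckWeight, Submodule.map_span_le]
    rintro _ ⟨i, ⟨hi, hs⟩, rfl⟩
    refine ⟨CyclicSum.rhoBar_zProd_mem_ker hi, ?_⟩
    have h := CyclicSum.rhoBar_zProd_mem_weight hi
    rwa [hs, Nat.sub_add_cancel (by omega)] at h
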